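/- Equip $\mathrm{GL}_2(\mathbb{Z}_2)$ with its usual (compact) $2$-adic topology and with a Haar measure $\mu$ on its Borel $\sigma$-algebra. For $A, B \in \mathrm{GL}_2(\mathbb{Z}_2)$ let $\langle A, B\rangle$ denote the closure of the subgroup generated by $A$ and $B$. Then the set of pairs $(A,B) \in \mathrm{GL}_2(\mathbb{Z}_2)^2$ for which $\langle A, B\rangle$ has infinite index in $\mathrm{GL}_2(\mathbb{Z}_2)$ has measure zero with respect to the product measure $\mu \times \mu$ (which is a Haar measure on $\mathrm{GL}_2(\mathbb{Z}_2)^2$). -/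

import Mathlib

open MeasureTheory
open scoped MatrixGroups

/-- For a subset `S` of a topological group, the closure of the subgroup generated by `S`. -/
def closedSubgroupGeneratedBy {G : Type*} [Group G] [TopologicalSpace G] [IsTopologicalGroup G]
    (S : Set G) : Subgroup G :=
  (Subgroup.closure S).topologicalClosure

/-! ### Congruence subgroups and successive approximation -/

section Congruence

open Filter Topology

/-! A generic pair generates an open subgroup H because logarithms of four conjugates of a power of
A span the Lie algebra M₂(ℚ₂). The logarithm itself is avoided: A¹² ≡ 1 mod 4, so A^(12·2^j) = 1 +
2^(j+2) N, and conjugation by 1, B, AB, A⁻¹B gives elements 1 + 2^(j+2) Yᵢ of H. By Cayley–Hamilton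
2^(j+2) N is a combination of 1 and A, so the coordinate determinant of the Yᵢ reduces to explicit
traces and determinants (`det_coordinateMatrix_one_add_smul`, `det_coordinateMatrix_conj`). Outside
four polynomial conditions on (A, B) it divides some 2^c, with c fixed before j is chosen; for j
large, `finiteIndex_of_span` puts a whole congruence subgroup inside H.

The exceptional conditions are null by `measure_eq_zero_of_finite_translates`: along translates by
integral unipotents, or by powers of an element of determinant 3, each becomes an equation in n with
finitely many solutions. Fubini passes to pairs. -/

/-- Reduction modulo `2 ^ m` of `2 × 2` matrices over `ℤ_[2]`. -/
noncomputable def matrixReduction (m : ℕ) :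
    Matrix (Fin 2) (Fin 2) ℤ_[2] →+* Matrix (Fin 2) (Fin 2) (ZMod (2 ^ m)) :=
  (PadicInt.toZModPow m).mapMatrix

/-- The principal congruence subgroup of level `2 ^ m` in `GL₂(ℤ₂)`. -/
noncomputable def principalCongruenceSubgroup (m : ℕ) : Subgroup (GL (Fin 2) ℤ_[2]) :=
  (Matrix.GeneralLinearGroup.map (n := Fin 2) (PadicInt.toZModPow (p := 2) m)).ker

theorem matrixReduction_eq_iff {m : ℕ} {X Y : Matrix (Fin 2) (Fin 2) ℤ_[2]} :
    matrixReduction m X = matrixReduction m Y ↔ ∃ R, X = Y + (2 : ℤ_[2]) ^ m • R := by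
  have key : ∀ x y : ℤ_[2], PadicInt.toZModPow m x = PadicInt.toZModPow m y ↔
      ∃ r, x = y + 2 ^ m * r := by
    intro x y
    rw [← sub_eq_zero, ← map_sub, ← RingHom.mem_ker, PadicInt.ker_toZModPow,
      Ideal.mem_span_singleton]
    constructor
    · rintro ⟨r, hr⟩
      exact ⟨r, by push_cast at hr; linear_combination hr⟩
    · rintro ⟨r, hr⟩
      exact ⟨r, by push_cast; linear_combination hr⟩
  rw [← Matrix.ext_iff]
  simp only [matrixReduction, RingHom.mapMatrix_apply, Matrix.map_apply, key]
  constructor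
  · intro h
    choose r hr using h
    exact ⟨Matrix.of r, by ext i j; simp [hr i j]⟩
  · rintro ⟨R, rfl⟩ i j
    exact ⟨R i j, by simp⟩

theorem mem_principalCongruenceSubgroup_iff {m : ℕ} {g : GL (Fin 2) ℤ_[2]} :
    g ∈ principalCongruenceSubgroup m ↔
      matrixReduction m (g : Matrix (Fin 2) (Fin 2) ℤ_[2]) = 1 := by
  rw [principalCongruenceSubgroup, MonoidHom.mem_ker, ← Units.val_inj]
  rfl

theorem inv_mul_mem_principalCongruenceSubgroup {m : ℕ} {g h : GL (Fin 2) ℤ_[2]}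
    (e : matrixReduction m (h : Matrix (Fin 2) (Fin 2) ℤ_[2]) = matrixReduction m g.1) :
    h⁻¹ * g ∈ principalCongruenceSubgroup m := by
  rw [mem_principalCongruenceSubgroup_iff, Units.val_mul, map_mul, ← e, ← map_mul, Units.inv_mul,
    map_one]

theorem exists_eq_one_add_of_mem_principalCongruenceSubgroup {m : ℕ} {g : GL (Fin 2) ℤ_[2]}
    (hg : g ∈ principalCongruenceSubgroup m) :
    ∃ R, (g : Matrix (Fin 2) (Fin 2) ℤ_[2]) = 1 + (2 : ℤ_[2]) ^ m • R := by
  rw [mem_principalCongruenceSubgroup_iff, ← map_one (matrixReduction m)] at hg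
  exact matrixReduction_eq_iff.1 hg

instance principalCongruenceSubgroup_finiteIndex (m : ℕ) :
    (principalCongruenceSubgroup m).FiniteIndex := by
  have : NeZero (2 ^ m) := ⟨by positivity⟩
  have : Finite (GL (Fin 2) (ZMod (2 ^ m))) :=
    Finite.of_injective _ Units.val_injective
  exact Subgroup.finiteIndex_ker _

theorem tendsto_one_of_mem_principalCongruenceSubgroup {u : ℕ → GL (Fin 2) ℤ_[2]}
    (hu : ∀ m, u m ∈ principalCongruenceSubgroup m) : Tendsto u atTop (𝓝 1) := by
  have key : ∀ v : ℕ → GL (Fin 2) ℤ_[2], (∀ m, v m ∈ principalCongruenceSubgroup m) →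
      Tendsto (fun m => (v m : Matrix (Fin 2) (Fin 2) ℤ_[2])) atTop (𝓝 1) := by
    intro v hv
    choose R hR using fun m => exists_eq_one_add_of_mem_principalCongruenceSubgroup (hv m)
    have h2 : ‖(2 : ℤ_[2])‖ < 1 := by
      have := PadicInt.norm_p (p := 2)
      push_cast at this
      rw [this]; norm_num
    have h0 : Tendsto (fun m => (2 : ℤ_[2]) ^ m • R m) atTop (𝓝 0) := by
      refine tendsto_pi_nhds.2 fun i => tendsto_pi_nhds.2 fun j => ?_
      refine squeeze_zero_norm (a := fun m => ‖(2 : ℤ_[2])‖ ^ m) (fun m => ?_)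
        (tendsto_pow_atTop_nhds_zero_of_lt_one (norm_nonneg _) h2)
      rw [Matrix.smul_apply, smul_eq_mul, norm_mul, norm_pow]
      exact mul_le_of_le_one_right (by positivity) (PadicInt.norm_le_one _)
    have h1 := (tendsto_const_nhds (x := (1 : Matrix (Fin 2) (Fin 2) ℤ_[2]))).add h0
    rw [add_zero] at h1
    exact h1.congr fun m => (hR m).symm
  rw [Units.isEmbedding_embedProduct.tendsto_nhds_iff]
  have h1 := key u hu
  have h2 := key (fun m => (u m)⁻¹) fun m => inv_mem (hu m)
  exact h1.prodMk_nhds ((MulOpposite.continuous_op.tendsto _).comp h2)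

theorem mem_of_forall_exists_inv_mul_mem {H : Subgroup (GL (Fin 2) ℤ_[2])}
    (hH : IsClosed (H : Set (GL (Fin 2) ℤ_[2]))) {g : GL (Fin 2) ℤ_[2]}
    (h : ∀ m, ∃ x ∈ H, x⁻¹ * g ∈ principalCongruenceSubgroup m) : g ∈ H := by
  choose x hx hxg using h
  have h1 := tendsto_one_of_mem_principalCongruenceSubgroup fun m => inv_mem (hxg m)
  have h2 := (tendsto_const_nhds (x := g)).mul h1
  rw [mul_one] at h2
  refine hH.mem_of_tendsto h2 (Eventually.of_forall fun m => ?_)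
  simpa using hx m

theorem one_add_smul_mul_one_add_smul {R : Type*} [CommRing R] {n : Type*} [Fintype n]
    [DecidableEq n] (a b : R) (X Y : Matrix n n R) :
    (1 + a • X) * (1 + b • Y) = 1 + a • X + b • Y + (a * b) • (X * Y) := by
  rw [add_mul, one_mul, mul_add, mul_one, smul_mul_smul]
  abel

/-- Iterated squaring of a matrix congruent to `1`. -/
theorem exists_one_add_smul_pow_two_pow {R : Type*} [CommRing R] {n : Type*} [Fintype n]
    [DecidableEq n] (k j : ℕ) (X : Matrix n n R) :
    ∃ Y : Matrix n n R, (1 + (2 : R) ^ (k + 1) • X) ^ 2 ^ j =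
      1 + (2 : R) ^ (k + 1 + j) • X + (2 : R) ^ (2 * k + j + 1) • Y := by
  induction j with
  | zero => exact ⟨0, by simp⟩
  | succ j ih =>
    obtain ⟨Y, hY⟩ := ih
    refine ⟨Y + (2 : R) ^ j • (X + (2 : R) ^ k • Y) ^ 2, ?_⟩
    have h1 : (1 : Matrix n n R) + (2 : R) ^ (k + 1 + j) • X + (2 : R) ^ (2 * k + j + 1) • Y =
        1 + (2 : R) ^ (k + 1 + j) • (X + (2 : R) ^ k • Y) := by
      rw [smul_add, smul_smul, ← pow_add, add_assoc]
      congr 4; ring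
    rw [pow_succ 2 j, pow_mul, hY, h1, sq, one_add_smul_mul_one_add_smul, ← sq (X + _)]
    module

variable {H : Subgroup (GL (Fin 2) ℤ_[2])}

/-- The matrices `X` such that `1 + 2 ^ s X` is congruent modulo `2 ^ m` to an element of `H`. -/
noncomputable def congruenceDirections (H : Subgroup (GL (Fin 2) ℤ_[2])) {s m : ℕ}
    (hs : m ≤ 2 * s) : Submodule ℤ_[2] (Matrix (Fin 2) (Fin 2) ℤ_[2]) where
  carrier := {X | ∃ h ∈ H, matrixReduction m (h : GL (Fin 2) ℤ_[2]).1 =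
    matrixReduction m (1 + (2 : ℤ_[2]) ^ s • X)}
  zero_mem' := ⟨1, one_mem _, by simp⟩
  add_mem' := by
    rintro X Y ⟨g, hg, eg⟩ ⟨h, hh, eh⟩
    refine ⟨g * h, mul_mem hg hh, ?_⟩
    rw [Units.val_mul, map_mul, eg, eh, ← map_mul, matrixReduction_eq_iff]
    -- Since m ≤ 2s, the cross term 2^(2s) XY dies modulo 2^m: multiplying in H adds directions.
    refine ⟨(2 : ℤ_[2]) ^ (2 * s - m) • (X * Y), ?_⟩
    rw [smul_smul, ← pow_add, Nat.add_sub_cancel' hs, one_add_smul_mul_one_add_smul]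
    module
  smul_mem' := by
    rintro a X ⟨h, hh, eh⟩
    have hn : ∀ n : ℕ, matrixReduction m (h ^ n).1 =
        matrixReduction m (1 + (2 : ℤ_[2]) ^ s • ((n : ℤ_[2]) • X)) := by
      intro n
      induction n with
      | zero => simp
      | succ n ih =>
        rw [pow_succ, Units.val_mul, map_mul, ih, eh, ← map_mul, matrixReduction_eq_iff]
        refine ⟨(2 : ℤ_[2]) ^ (2 * s - m) • (n : ℤ_[2]) • (X * X), ?_⟩
        rw [smul_smul ((2 : ℤ_[2]) ^ m), ← pow_add, Nat.add_sub_cancel' hs,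
          one_add_smul_mul_one_add_smul, smul_mul_assoc]
        push_cast
        module
    -- A natural number congruent to `a` modulo 2^m turns scaling into a power in H.
    refine ⟨h ^ a.appr m, pow_mem hh _, ?_⟩
    rw [hn, matrixReduction_eq_iff]
    obtain ⟨r, hr⟩ := Ideal.mem_span_singleton.1 (PadicInt.appr_spec m a)
    refine ⟨-((2 : ℤ_[2]) ^ s • r • X), ?_⟩
    generalize a.appr m = n at hr ⊢
    rw [sub_eq_iff_eq_add] at hr
    subst hr
    push_cast
    module

/-- A closed subgroup of `GL₂(ℤ₂)` that contains elements `1 + 2 ^ k N i` for which the `N i` span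
a lattice containing `2 ^ c M₂(ℤ₂)`, with `c` small compared to `k`, has finite index. -/
theorem finiteIndex_of_span (hH : IsClosed (H : Set (GL (Fin 2) ℤ_[2]))) {ι : Type*}
    {h : ι → GL (Fin 2) ℤ_[2]} {N : ι → Matrix (Fin 2) (Fin 2) ℤ_[2]} {k c : ℕ}
    (hh : ∀ i, h i ∈ H) (hN : ∀ i, (h i).1 = 1 + (2 : ℤ_[2]) ^ k • N i) (hc : c + 2 ≤ k)
    (hspan : ∀ M, (2 : ℤ_[2]) ^ c • M ∈ Submodule.span ℤ_[2] (Set.range N)) :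
    H.FiniteIndex := by
  have step : ∀ m, k + c ≤ m → ∀ g ∈ principalCongruenceSubgroup m,
      ∃ x ∈ H, x⁻¹ * g ∈ principalCongruenceSubgroup (m + 1) := by
    intro m hm g hg
    obtain ⟨M, hM⟩ := exists_eq_one_add_of_mem_principalCongruenceSubgroup hg
    -- Repeated squaring moves each `N i` to level m - c, where the span supplies 2^c M, that is, M
    -- at level m. The bound c + 2 ≤ k pushes all quadratic errors into 2^(m+1).
    have hs : m + 1 ≤ 2 * (m - c) := by omega
    have hle : Submodule.span ℤ_[2] (Set.range N) ≤ congruenceDirections H hs := by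
      rw [Submodule.span_le]
      rintro _ ⟨i, rfl⟩
      refine ⟨h i ^ 2 ^ (m - c - k), pow_mem (hh i) _, ?_⟩
      obtain ⟨k, rfl⟩ : ∃ k', k = k' + 1 := ⟨k - 1, by omega⟩
      obtain ⟨Y, hY⟩ := exists_one_add_smul_pow_two_pow k (m - c - (k + 1)) (N i)
      rw [Units.val_pow_eq_pow_val, hN, hY, matrixReduction_eq_iff,
        show k + 1 + (m - c - (k + 1)) = m - c by omega]
      refine ⟨(2 : ℤ_[2]) ^ (2 * k + (m - c - (k + 1)) + 1 - (m + 1)) • Y, ?_⟩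
      rw [smul_smul, ← pow_add]
      congr 3
      omega
    obtain ⟨x, hx, ex⟩ := hle (hspan M)
    refine ⟨x, hx, inv_mul_mem_principalCongruenceSubgroup ?_⟩
    rw [ex, hM, smul_smul, ← pow_add, Nat.sub_add_cancel (by omega)]
  have approx : ∀ g ∈ principalCongruenceSubgroup (k + c), ∀ l,
      ∃ x ∈ H, x⁻¹ * g ∈ principalCongruenceSubgroup (k + c + l) := by
    intro g hg l
    induction l with
    | zero => exact ⟨1, one_mem _, by simpa using hg⟩
    | succ l ih =>
      obtain ⟨x, hx, hxg⟩ := ih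
      obtain ⟨y, hy, hyg⟩ := step _ (by omega) _ hxg
      exact ⟨x * y, mul_mem hx hy, by rwa [mul_inv_rev, mul_assoc]⟩
  have anti : ∀ {m n : ℕ}, m ≤ n → principalCongruenceSubgroup n ≤ principalCongruenceSubgroup m := by
    intro m n hmn g hg
    obtain ⟨R, hR⟩ := exists_eq_one_add_of_mem_principalCongruenceSubgroup hg
    rw [mem_principalCongruenceSubgroup_iff, ← map_one (matrixReduction m), matrixReduction_eq_iff]
    exact ⟨(2 : ℤ_[2]) ^ (n - m) • R, by rw [hR, smul_smul, ← pow_add, Nat.add_sub_cancel' hmn]⟩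
  have hle : principalCongruenceSubgroup (k + c) ≤ H := by
    intro g hg
    refine mem_of_forall_exists_inv_mul_mem hH fun m => ?_
    obtain ⟨x, hx, hxg⟩ := approx g hg m
    exact ⟨x, hx, anti (by omega) hxg⟩
  exact Subgroup.finiteIndex_of_le hle

end Congruence

/-! ### Determinants of four matrices in M₂ -/

section Coordinates

variable {R : Type*} [CommRing R]

/-- The matrix whose rows are the coordinate vectors of four `2 × 2` matrices. -/
def coordinateMatrix (X : Fin 4 → Matrix (Fin 2) (Fin 2) R) : Matrix (Fin 4) (Fin 4) R :=
  Matrix.of fun i => ![X i 0 0, X i 0 1, X i 1 0, X i 1 1]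

theorem det_coordinateMatrix_smul_mem_span (X : Fin 4 → Matrix (Fin 2) (Fin 2) R)
    (M : Matrix (Fin 2) (Fin 2) R) :
    (coordinateMatrix X).det • M ∈ Submodule.span R (Set.range X) := by
  set m : Fin 4 → R := ![M 0 0, M 0 1, M 1 0, M 1 1] with hm
  set w := Matrix.vecMul m (coordinateMatrix X).adjugate with hw
  have h1 : Matrix.vecMul w (coordinateMatrix X) = (coordinateMatrix X).det • m := by
    rw [hw, Matrix.vecMul_vecMul, Matrix.adjugate_mul, Matrix.vecMul_smul, Matrix.vecMul_one]
  have h2 : (coordinateMatrix X).det • M = ∑ i, w i • X i := by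
    have e := fun l => (congr_fun h1 l).symm
    have e0 := e 0
    have e1 := e 1
    have e2 := e 2
    have e3 := e 3
    simp only [Matrix.vecMul, dotProduct, Fin.sum_univ_four, Pi.smul_apply, smul_eq_mul] at e0 e1 e2 e3
    ext i j
    simp only [Fin.sum_univ_four, Matrix.smul_apply, Matrix.add_apply, smul_eq_mul]
    fin_cases i <;> fin_cases j
    · simpa [coordinateMatrix, hm] using e0
    · simpa [coordinateMatrix, hm] using e1
    · simpa [coordinateMatrix, hm] using e2
    · simpa [coordinateMatrix, hm] using e3
  rw [h2]
  exact Submodule.sum_mem _ fun i _ =>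
    Submodule.smul_mem _ _ (Submodule.subset_span (Set.mem_range_self i))

theorem det_coordinateMatrix_smul (a : R) (X : Fin 4 → Matrix (Fin 2) (Fin 2) R) :
    (coordinateMatrix fun i => a • X i).det = a ^ 4 * (coordinateMatrix X).det := by
  have : coordinateMatrix (fun i => a • X i) = a • coordinateMatrix X := by
    ext i l
    fin_cases l <;> simp [coordinateMatrix]
  rw [this, Matrix.det_smul, Fintype.card_fin]

theorem det_fin_four (V : Matrix (Fin 4) (Fin 4) R) :
    V.det =
      V 0 0 * (V 1 1 * (V 2 2 * V 3 3 - V 2 3 * V 3 2) - V 1 2 * (V 2 1 * V 3 3 - V 2 3 * V 3 1)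
        + V 1 3 * (V 2 1 * V 3 2 - V 2 2 * V 3 1))
      - V 0 1 * (V 1 0 * (V 2 2 * V 3 3 - V 2 3 * V 3 2) - V 1 2 * (V 2 0 * V 3 3 - V 2 3 * V 3 0)
        + V 1 3 * (V 2 0 * V 3 2 - V 2 2 * V 3 0))
      + V 0 2 * (V 1 0 * (V 2 1 * V 3 3 - V 2 3 * V 3 1) - V 1 1 * (V 2 0 * V 3 3 - V 2 3 * V 3 0)
        + V 1 3 * (V 2 0 * V 3 1 - V 2 1 * V 3 0))
      - V 0 3 * (V 1 0 * (V 2 1 * V 3 2 - V 2 2 * V 3 1) - V 1 1 * (V 2 0 * V 3 2 - V 2 2 * V 3 0)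
        + V 1 2 * (V 2 0 * V 3 1 - V 2 1 * V 3 0)) := by
  rw [Matrix.det_succ_row_zero]
  simp only [Fin.sum_univ_four, Matrix.det_fin_three, Matrix.submatrix_apply]
  have e1 : (1 : Fin 4).succAbove = ![0, 2, 3] := by decide
  have e2 : (2 : Fin 4).succAbove = ![0, 1, 3] := by decide
  have e3 : (3 : Fin 4).succAbove = ![0, 1, 2] := by decide
  have e0 : (0 : Fin 4).succAbove = ![1, 2, 3] := by decide
  have s0 : (0 : Fin 3).succ = 1 := rfl
  have s1 : (1 : Fin 3).succ = 2 := rfl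
  have s2 : (2 : Fin 3).succ = 3 := rfl
  simp only [e0, e1, e2, e3, s0, s1, s2, Matrix.cons_val]
  simp
  ring

/-- Subtracting the first row makes the other three traceless, so the determinant sees the first row
only through its trace 2a + bt; the factor 2 is the trace of 1. -/
theorem det_coordinateMatrix_one_add_smul (a b t : R) (X : Fin 4 → Matrix (Fin 2) (Fin 2) R)
    (hX : ∀ i, (X i).trace = t) :
    2 * (coordinateMatrix fun i => a • (1 : Matrix (Fin 2) (Fin 2) R) + b • X i).det =
      b ^ 3 * (2 * a + b * t) *
        (coordinateMatrix ![1, X 1 - X 0, X 2 - X 0, X 3 - X 0]).det := by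
  have h : ∀ i, X i 1 1 = t - X i 0 0 := fun i => by
    rw [← hX i, Matrix.trace_fin_two]; ring
  rw [det_fin_four, det_fin_four]
  simp [coordinateMatrix, h]
  ring

theorem det_coordinateMatrix_smul_smul (s : R) (X Y Z W : Matrix (Fin 2) (Fin 2) R) :
    (coordinateMatrix ![X, Y, s • Z, s • W]).det = s ^ 2 * (coordinateMatrix ![X, Y, Z, W]).det := by
  rw [det_fin_four, det_fin_four]
  simp only [coordinateMatrix, Matrix.of_apply, Matrix.cons_val, Matrix.smul_apply, smul_eq_mul]
  ring

/-- Adjugates clear denominators: for invertible A the last two entries are det A times ACA⁻¹ - A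
and A⁻¹CA - A. The last factor in `key` is det(AC - CA), which detects a common eigenvector; it
splits because the determinants agree. -/
theorem det_coordinateMatrix_conj (A C : Matrix (Fin 2) (Fin 2) R) (ht : C.trace = A.trace)
    (hd : C.det = A.det) :
    (coordinateMatrix ![1, C - A, A * C * A.adjugate - A.det • A,
      A.adjugate * C * A - A.det • A]).det =
      2 * A.trace * ((A * C).trace - A.trace ^ 2 + 2 * A.det) ^ 2 *
        ((A * C).trace - 2 * A.det) := by
  have key : (coordinateMatrix ![1, C - A, A * C * A.adjugate - A.det • A,
      A.adjugate * C * A - A.det • A]).det =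
      -2 * A.trace * ((A * C).trace - A.trace ^ 2 + 2 * A.det) * (4 * A.det * C.det -
        A.trace ^ 2 * (A.det + C.det) - (A * C).trace ^ 2 + (A * C).trace * A.trace ^ 2) := by
    obtain ⟨a, b, c, d, rfl⟩ : ∃ a b c d, A = !![a, b; c, d] := ⟨_, _, _, _, A.eta_fin_two⟩
    obtain ⟨e, f, g, h, rfl⟩ : ∃ e f g h, C = !![e, f; g, h] := ⟨_, _, _, _, C.eta_fin_two⟩
    rw [Matrix.trace_fin_two_of, Matrix.trace_fin_two_of] at ht
    obtain rfl : h = a + d - e := by linear_combination ht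
    rw [det_fin_four]
    simp only [coordinateMatrix, Matrix.adjugate_fin_two_of, Matrix.mul_fin_two, Matrix.det_fin_two_of,
      Matrix.trace_fin_two_of, Matrix.of_apply, Matrix.cons_val, Matrix.sub_apply, Matrix.smul_apply,
      Matrix.one_apply, smul_eq_mul]
    simp
    ring
  rw [key, hd]
  ring

end Coordinates

/-! ### Cayley–Hamilton for 2 × 2 matrices -/

section TwoByTwo

variable {R : Type*} [CommRing R]

theorem sq_eq_trace_smul_sub (A : Matrix (Fin 2) (Fin 2) R) :
    A ^ 2 = A.trace • A - A.det • (1 : Matrix (Fin 2) (Fin 2) R) := by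
  rw [sq]
  ext i j
  fin_cases i <;> fin_cases j <;>
    simp [Matrix.mul_apply, Fin.sum_univ_two, Matrix.det_fin_two, Matrix.trace_fin_two] <;> ring

theorem exists_pow_eq_smul_one_add_smul (A : Matrix (Fin 2) (Fin 2) R) (n : ℕ) :
    ∃ a b : R, A ^ n = a • (1 : Matrix (Fin 2) (Fin 2) R) + b • A := by
  induction n with
  | zero => exact ⟨1, 0, by simp⟩
  | succ n ih =>
    obtain ⟨a, b, h⟩ := ih
    refine ⟨-(b * A.det), a + b * A.trace, ?_⟩
    rw [pow_succ, h, add_mul, smul_mul_assoc, one_mul, smul_mul_assoc, ← sq,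
      sq_eq_trace_smul_sub]
    module

theorem det_one_add_smul_fin_two (s : R) (N : Matrix (Fin 2) (Fin 2) R) :
    (1 + s • N).det = 1 + s * N.trace + s ^ 2 * N.det := by
  simp [Matrix.det_fin_two, Matrix.trace_fin_two]
  ring

end TwoByTwo

/-! ### Units and divisibility in ℤ₂ -/

section PadicInt

theorem isUnit_add_two_mul {u : ℤ_[2]} (hu : IsUnit u) (x : ℤ_[2]) : IsUnit (u + 2 * x) := by
  by_contra h
  have h1 := (PadicInt.norm_lt_one_iff_dvd _).1 (PadicInt.not_isUnit_iff.1 h)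
  have h2 : ((2 : ℕ) : ℤ_[2]) ∣ u := by
    have := dvd_sub h1 (Dvd.intro x rfl : ((2 : ℕ) : ℤ_[2]) ∣ (2 : ℕ) * x)
    simpa using this
  exact PadicInt.not_isUnit_iff.2 ((PadicInt.norm_lt_one_iff_dvd _).2 h2) hu

theorem exists_dvd_two_pow {x : ℤ_[2]} (hx : x ≠ 0) : ∃ n : ℕ, x ∣ 2 ^ n := by
  refine ⟨x.valuation, ?_⟩
  have h := PadicInt.unitCoeff_spec hx
  have h2 : x ∣ ((2 : ℕ) : ℤ_[2]) ^ x.valuation := by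
    nth_rw 1 [h]
    exact (Units.mul_left_dvd).2 dvd_rfl
  simpa using h2

theorem exists_pow_twelve_eq_one_add (A : GL (Fin 2) ℤ_[2]) :
    ∃ N, (A ^ 12).1 = 1 + (2 : ℤ_[2]) ^ 2 • N := by
  -- GL₂(𝔽₂) ≅ S₃ has exponent 6; one more squaring improves the congruence from 2 to 4.
  have h6 : ∀ M : Matrix (Fin 2) (Fin 2) (ZMod (2 ^ 1)), IsUnit M.det → M ^ 6 = 1 := by
    decide +kernel
  have h := h6 (matrixReduction 1 A.1) ((Matrix.isUnit_iff_isUnit_det _).1 (A.isUnit.map _))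
  rw [← map_pow, ← map_one (matrixReduction 1), matrixReduction_eq_iff] at h
  obtain ⟨R, hR⟩ := h
  refine ⟨R + R * R, ?_⟩
  rw [show 12 = 6 * 2 from rfl, Units.val_pow_eq_pow_val, pow_mul, hR, sq,
    one_add_smul_mul_one_add_smul]
  module

end PadicInt

/-! ### Finite index outside the exceptional conditions -/

section Generation

/-- The shape of the iterated squares of a matrix `M = 1 + 4 N` in the algebra generated by `A`. -/
theorem exists_pow_two_pow_eq {A M : Matrix (Fin 2) (Fin 2) ℤ_[2]} {a b : ℤ_[2]}
    (hM : ∃ N, M = 1 + (2 : ℤ_[2]) ^ 2 • N)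
    (hab : M = a • (1 : Matrix (Fin 2) (Fin 2) ℤ_[2]) + b • A) (j : ℕ) :
    ∃ (N : Matrix (Fin 2) (Fin 2) ℤ_[2]) (a' w v : ℤ_[2]), IsUnit w ∧ IsUnit v ∧
      M ^ 2 ^ j = 1 + (2 : ℤ_[2]) ^ (j + 2) • N ∧
      M ^ 2 ^ j = a' • (1 : Matrix (Fin 2) (Fin 2) ℤ_[2]) + (2 ^ j * w * b) • A ∧
      (M ^ 2 ^ j).det = 1 + 2 ^ j * v * (M.det - 1) := by
  obtain ⟨N₀, hN₀⟩ := hM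
  induction j with
  | zero => exact ⟨N₀, a, 1, 1, isUnit_one, isUnit_one, by simp [hN₀], by simp [hab], by simp⟩
  | succ j ih =>
    obtain ⟨N, a', w, v, hw, hv, h1, h2, h3⟩ := ih
    -- Congruence to 1 modulo 4 makes both the trace and 1 + det of the current power twice a unit.
    -- Squaring therefore multiplies the coefficient of A, and det - 1, by 2 up to a unit.
    have htr : (M ^ 2 ^ j).trace = 2 * (1 + 2 * (2 ^ j * N.trace)) := by
      rw [h1, Matrix.trace_add, Matrix.trace_smul, Matrix.trace_one, Fintype.card_fin, smul_eq_mul]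
      push_cast
      ring
    have hdet : M.det - 1 = 2 * (2 * (N₀.trace + 4 * N₀.det)) := by
      rw [hN₀, det_one_add_smul_fin_two]
      ring
    refine ⟨N + (2 : ℤ_[2]) ^ (j + 1) • (N * N),
      (M ^ 2 ^ j).trace * a' - (M ^ 2 ^ j).det, w * (1 + 2 * (2 ^ j * N.trace)),
      v * (1 + 2 * (2 ^ j * v * (N₀.trace + 4 * N₀.det))),
      hw.mul (isUnit_add_two_mul isUnit_one _), hv.mul (isUnit_add_two_mul isUnit_one _), ?_, ?_, ?_⟩
    · rw [pow_succ 2 j, pow_mul, h1, sq, one_add_smul_mul_one_add_smul]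
      module
    · rw [pow_succ 2 j, pow_mul, sq_eq_trace_smul_sub]
      nth_rw 2 [h2]
      rw [htr]
      module
    · rw [pow_succ 2 j, pow_mul, Matrix.det_pow, h3, hdet]
      ring

theorem finiteIndex_closedSubgroupGeneratedBy_pair {A B : GL (Fin 2) ℤ_[2]}
    (hA : (A.1 ^ 12) 1 0 ≠ 0) (hdet : A.1.det ^ 12 ≠ 1)
    (h1 : (A.1 * (B * A * B⁻¹).1).trace ≠ A.1.trace ^ 2 - 2 * A.1.det)
    (h2 : (A.1 * (B * A * B⁻¹).1).trace ≠ 2 * A.1.det) :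
    (closedSubgroupGeneratedBy {A, B}).FiniteIndex := by
  set H := closedSubgroupGeneratedBy {A, B} with hH
  have hclosed : IsClosed (H : Set (GL (Fin 2) ℤ_[2])) :=
    Subgroup.isClosed_topologicalClosure _
  have hAH : A ∈ H := Subgroup.le_topologicalClosure _ (Subgroup.subset_closure (by simp))
  have hBH : B ∈ H := Subgroup.le_topologicalClosure _ (Subgroup.subset_closure (by simp))
  set δ := A.1.det with hδ
  -- Trace zero would make A², hence A¹², scalar.
  have htr : A.1.trace ≠ 0 := by
    intro h
    apply hA
    rw [show 12 = 2 * 6 from rfl, pow_mul, sq_eq_trace_smul_sub, h, zero_smul, zero_sub,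
      ← neg_smul, smul_pow, one_pow]
    simp
  obtain ⟨a, b, hab⟩ := exists_pow_eq_smul_one_add_smul A.1 12
  have hb : b ≠ 0 := by
    rintro rfl
    apply hA
    rw [hab]
    simp
  let g : Fin 4 → GL (Fin 2) ℤ_[2] := ![1, B, A * B, A⁻¹ * B]
  have hgH : ∀ i, g i ∈ H := by
    intro i
    fin_cases i
    · exact one_mem _
    · exact hBH
    · exact mul_mem hAH hBH
    · exact mul_mem (inv_mem hAH) hBH
  let X : Fin 4 → Matrix (Fin 2) (Fin 2) ℤ_[2] := fun i => (g i).1 * A.1 * (g i)⁻¹.1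
  have hX : ∀ i, (X i).trace = A.1.trace := fun i => Matrix.trace_units_conj _ _
  set Q := (coordinateMatrix ![1, X 1 - X 0, X 2 - X 0, X 3 - X 0]).det with hQdef
  have hadj : A.1.adjugate = δ • (A⁻¹).1 := by
    rw [← mul_one A.1.adjugate, ← A.mul_inv, ← mul_assoc, Matrix.adjugate_mul, smul_mul_assoc,
      one_mul]
  have hQ : Q ≠ 0 := by
    intro hQ0
    have key := det_coordinateMatrix_conj A.1 (B * A * B⁻¹).1
      (Matrix.trace_units_conj B A.1) (Matrix.det_units_conj B A.1)
    have e2 : A.1 * (B * A * B⁻¹).1 * A.1.adjugate - A.1.det • A.1 = δ • (X 2 - X 0) := by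
      have hX2 : X 2 = (A * B).1 * A.1 * (A * B)⁻¹.1 := rfl
      have hX0 : X 0 = A.1 := by simp [X, g]
      rw [hadj, mul_smul_comm, ← smul_sub, hX2, hX0, mul_inv_rev]
      simp only [Units.val_mul, mul_assoc]
    have e3 : A.1.adjugate * (B * A * B⁻¹).1 * A.1 - A.1.det • A.1 = δ • (X 3 - X 0) := by
      have hX3 : X 3 = (A⁻¹ * B).1 * A.1 * (A⁻¹ * B)⁻¹.1 := rfl
      have hX0 : X 0 = A.1 := by simp [X, g]
      rw [hadj, smul_mul_assoc, smul_mul_assoc, ← smul_sub, hX3, hX0, mul_inv_rev, inv_inv]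
      simp only [Units.val_mul, mul_assoc]
    have e1 : (B * A * B⁻¹).1 - A.1 = X 1 - X 0 := by simp [X, g]
    rw [e1, e2, e3, det_coordinateMatrix_smul_smul, ← hQdef, hQ0, mul_zero] at key
    have n1 : (A.1 * (B * A * B⁻¹).1).trace - A.1.trace ^ 2 + 2 * A.1.det ≠ 0 := fun h =>
      h1 (by linear_combination h)
    have n2 : (A.1 * (B * A * B⁻¹).1).trace - 2 * A.1.det ≠ 0 := sub_ne_zero.2 h2
    exact mul_ne_zero (mul_ne_zero (mul_ne_zero two_ne_zero htr) (pow_ne_zero 2 n1)) n2 key.symm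
  have hd : δ ^ 12 - 1 ≠ 0 := sub_ne_zero.2 hdet
  obtain ⟨s, e, he⟩ := exists_dvd_two_pow hd
  obtain ⟨c, hc⟩ := exists_dvd_two_pow (mul_ne_zero (mul_ne_zero (pow_ne_zero 3 hb) hd) hQ)
  have hpow : ∃ N, A.1 ^ 12 = 1 + (2 : ℤ_[2]) ^ 2 • N := exists_pow_twelve_eq_one_add A
  -- In j = s + c, the part s lets δ¹² - 1 divide 2^j, so the quadratic term of det(1 + 2^(j+2) N)
  -- only perturbs the unit in `htrN`; the part c gives c + 2 ≤ j + 2.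
  obtain ⟨N, a', w, v, hw, hv, e1, e2, e3⟩ := exists_pow_two_pow_eq hpow hab (s + c)
  set j := s + c with hj
  have h2j : ∀ n : ℕ, (2 : ℤ_[2]) ^ n ≠ 0 := fun n => pow_ne_zero n two_ne_zero
  have htrN : 4 * N.trace = (δ ^ 12 - 1) * (v + 2 * (-8 * (e * 2 ^ c) * N.det)) := by
    rw [e1, det_one_add_smul_fin_two, Matrix.det_pow] at e3
    apply mul_left_cancel₀ (h2j j)
    have : (2 : ℤ_[2]) ^ j = (δ ^ 12 - 1) * e * 2 ^ c := by rw [hj, pow_add, he]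
    linear_combination e3 - 16 * 2 ^ j * N.det * this
  have hNdvd : (δ ^ 12 - 1) * (b ^ 3 * Q) ∣ 2 ^ c := by
    rwa [show (δ ^ 12 - 1) * (b ^ 3 * Q) = b ^ 3 * (δ ^ 12 - 1) * Q by ring]
  let Y : Fin 4 → Matrix (Fin 2) (Fin 2) ℤ_[2] := fun i => (g i).1 * N * (g i)⁻¹.1
  have hY : ∀ i, (2 : ℤ_[2]) ^ (j + 2) • Y i =
      (a' - 1) • (1 : Matrix (Fin 2) (Fin 2) ℤ_[2]) + (2 ^ j * w * b) • X i := by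
    intro i
    have e4 : (2 : ℤ_[2]) ^ (j + 2) • N =
        (a' - 1) • (1 : Matrix (Fin 2) (Fin 2) ℤ_[2]) + (2 ^ j * w * b) • A.1 := by
      rw [e1, ← sub_eq_iff_eq_add'] at e2
      rw [← e2]
      module
    calc (2 : ℤ_[2]) ^ (j + 2) • Y i = (g i).1 * ((2 : ℤ_[2]) ^ (j + 2) • N) * (g i)⁻¹.1 := by
          simp [Y]
      _ = _ := by
          rw [e4, mul_add, add_mul, mul_smul_comm, mul_one, smul_mul_assoc, Units.mul_inv,
            mul_smul_comm, smul_mul_assoc]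
  have htr2 : 2 * (a' - 1) + 2 ^ j * w * b * A.1.trace = 2 ^ (j + 2) * N.trace := by
    have := congrArg Matrix.trace (hY 0)
    simp only [Matrix.trace_add, Matrix.trace_smul, Matrix.trace_one, Fintype.card_fin, hX, Y,
      Matrix.trace_units_conj, smul_eq_mul] at this
    push_cast at this
    linear_combination -this
  -- The factor 2^(4j) cancels, so only unit factors on the right depend on j.
  have hD : 2 ^ 9 * (coordinateMatrix Y).det =
      w ^ 3 * (v + 2 * (-8 * (e * 2 ^ c) * N.det)) * ((δ ^ 12 - 1) * (b ^ 3 * Q)) := by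
    have key := det_coordinateMatrix_one_add_smul (a' - 1) (2 ^ j * w * b) A.1.trace X hX
    rw [← funext hY, det_coordinateMatrix_smul, htr2, ← hQdef] at key
    apply mul_left_cancel₀ (h2j (4 * j))
    have p1 : (2 : ℤ_[2]) ^ (4 * j) = (2 ^ j) ^ 4 := by rw [← pow_mul, mul_comm]
    have p2 : (2 : ℤ_[2]) ^ (j + 2) = 2 ^ j * 4 := by rw [pow_add]; norm_num
    rw [p2] at key
    rw [p1]
    linear_combination key + (2 ^ j) ^ 4 * w ^ 3 * b ^ 3 * Q * htrN
  have hdvd : (coordinateMatrix Y).det ∣ 2 ^ c := by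
    have hu : IsUnit (w ^ 3 * (v + 2 * (-8 * (e * 2 ^ c) * N.det))) :=
      (hw.pow 3).mul (isUnit_add_two_mul hv _)
    exact ((Dvd.intro_left _ hD).trans (hu.mul_left_dvd.2 dvd_rfl)).trans hNdvd
  refine finiteIndex_of_span hclosed (h := fun i => g i * A ^ (12 * 2 ^ j) * (g i)⁻¹) (N := Y)
    (k := j + 2) (c := c) (fun i => mul_mem (mul_mem (hgH i) (pow_mem hAH _)) (inv_mem (hgH i)))
    (fun i => ?_) (by omega) fun M => ?_
  · rw [Units.val_mul, Units.val_mul, Units.val_pow_eq_pow_val, pow_mul, e1, mul_add, add_mul,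
      mul_one, Units.mul_inv, mul_smul_comm, smul_mul_assoc]
  · obtain ⟨r, hr⟩ := hdvd
    rw [hr, mul_comm, mul_smul]
    exact Submodule.smul_mem _ _ (det_coordinateMatrix_smul_mem_span Y M)

end Generation

/-! ### The exceptional conditions have measure zero -/

section NullSets

/-- A measurable set meeting each orbit of a sequence of left translations in finitely many terms
is null for a finite left invariant measure. -/
theorem measure_eq_zero_of_finite_translates {G : Type*} [Group G] [MeasurableSpace G]
    [MeasurableMul G] (μ : Measure G) [μ.IsMulLeftInvariant] [IsFiniteMeasure μ] {Z : Set G}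
    (hZ : MeasurableSet Z) (x : ℕ → G) (h : ∀ g, {n | x n * g ∈ Z}.Finite) : μ Z = 0 := by
  -- These tail unions decrease to ∅, yet each contains a translate of Z, of measure μ Z.
  let U : ℕ → Set G := fun m => ⋃ n ≥ m, (fun g => x n * g) ⁻¹' Z
  have hU : ∀ m, MeasurableSet (U m) := fun m =>
    MeasurableSet.biUnion (Set.to_countable _) fun n _ => measurable_const_mul (x n) hZ
  have hanti : Antitone U := fun m m' hmm => Set.biUnion_subset_biUnion_left fun n hn =>
    le_trans hmm hn
  have hempty : ⋂ m, U m = ∅ := by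
    rw [Set.eq_empty_iff_forall_notMem]
    intro g hg
    obtain ⟨m, hm⟩ := (h g).bddAbove
    have := Set.mem_iInter.1 hg (m + 1)
    simp only [U, Set.mem_iUnion, Set.mem_preimage] at this
    obtain ⟨n, hn, hng⟩ := this
    have := hm hng
    omega
  have hlim := tendsto_measure_iInter_atTop (μ := μ) (fun m => (hU m).nullMeasurableSet) hanti
    ⟨0, measure_ne_top μ _⟩
  rw [hempty, measure_empty] at hlim
  refine le_antisymm (ge_of_tendsto' hlim fun m => ?_) zero_le
  rw [← measure_preimage_mul μ (x m) Z]
  exact measure_mono (Set.subset_biUnion_of_mem (u := fun n => (fun g => x n * g) ⁻¹' Z)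
    (le_refl m))

theorem finite_setOf_natCast_isRoot {R : Type*} [CommRing R] [IsDomain R] [CharZero R]
    {P : Polynomial R} (hP : P ≠ 0) {a b : R} (hb : b ≠ 0) :
    {n : ℕ | P.eval (a + n * b) = 0}.Finite := by
  refine (Polynomial.finite_setOfPred_isRoot hP).preimage (f := fun n : ℕ => a + n * b) ?_
  intro n _ m _ hnm
  exact Nat.cast_injective (mul_right_cancel₀ hb (add_left_cancel hnm))

theorem finite_setOf_natCast_quadratic {R : Type*} [CommRing R] [IsDomain R] [CharZero R]
    {a b c : R} (h : ¬(a = 0 ∧ b = 0 ∧ c = 0)) :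
    {n : ℕ | a + b * n + c * n ^ 2 = 0}.Finite := by
  have hP : Polynomial.C c * Polynomial.X ^ 2 + Polynomial.C b * Polynomial.X + Polynomial.C a
      ≠ 0 := by
    intro h0
    refine h ⟨?_, ?_, ?_⟩
    · simpa using congrArg (Polynomial.coeff · 0) h0
    · simpa using congrArg (Polynomial.coeff · 1) h0
    · simpa [Polynomial.coeff_C] using congrArg (Polynomial.coeff · 2) h0
  refine (finite_setOf_natCast_isRoot hP (a := 0) one_ne_zero).subset fun n hn => ?_
  simp only [Set.mem_ofPred_eq] at hn ⊢
  simp only [Polynomial.eval_add, Polynomial.eval_mul, Polynomial.eval_C, Polynomial.eval_pow,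
    Polynomial.eval_X]
  linear_combination hn

/-- Upper unipotent elements of `GL₂`. -/
def upperUnipotent {R : Type*} [CommRing R] (t : R) : GL (Fin 2) R where
  val := !![1, t; 0, 1]
  inv := !![1, -t; 0, 1]
  val_inv := by simp [Matrix.one_fin_two]
  inv_val := by simp [Matrix.one_fin_two]

/-- Lower unipotent elements of `GL₂`. -/
def lowerUnipotent {R : Type*} [CommRing R] (t : R) : GL (Fin 2) R where
  val := !![1, 0; t, 1]
  inv := !![1, 0; -t, 1]
  val_inv := by simp [Matrix.one_fin_two]
  inv_val := by simp [Matrix.one_fin_two]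

theorem upperUnipotent_conj {R : Type*} [CommRing R] (t : R) (C : GL (Fin 2) R) :
    (upperUnipotent t * C * (upperUnipotent t)⁻¹).1 =
      !![C.1 0 0 + t * C.1 1 0, C.1 0 1 + t * (C.1 1 1 - C.1 0 0) - t ^ 2 * C.1 1 0;
        C.1 1 0, C.1 1 1 - t * C.1 1 0] := by
  change !![1, t; 0, 1] * C.1 * !![1, -t; 0, 1] = _
  generalize C.1 = M
  rw [M.eta_fin_two, Matrix.mul_fin_two, Matrix.mul_fin_two]
  ext i j
  fin_cases i <;> fin_cases j <;> simp <;> ring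

theorem lowerUnipotent_conj_apply_one_zero {R : Type*} [CommRing R] (t : R) (C : GL (Fin 2) R) :
    (lowerUnipotent t * C * (lowerUnipotent t)⁻¹).1 1 0 =
      C.1 1 0 + (C.1 0 0 - C.1 1 1) * t + -C.1 0 1 * t ^ 2 := by
  change (!![1, 0; t, 1] * C.1 * !![1, 0; -t, 1]) 1 0 = _
  generalize C.1 = M
  rw [M.eta_fin_two, Matrix.mul_fin_two, Matrix.mul_fin_two]
  simp
  ring

theorem mul_conj_eq {G : Type*} [Group G] (u g a : G) :
    u * g * a * (u * g)⁻¹ = u * (g * a * g⁻¹) * u⁻¹ := by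
  group

theorem pow_twelve_apply_one_zero {R : Type*} [CommRing R] (A : Matrix (Fin 2) (Fin 2) R) :
    (A ^ 12) 1 0 = (A.trace ^ 2 - A.det) * (A.trace * (A.trace ^ 2 - 3 * A.det)) *
      ((A.trace * (A.trace ^ 2 - 3 * A.det)) ^ 2 - 2 * A.det ^ 3) * A 1 0 := by
  have hsq : ∀ B : Matrix (Fin 2) (Fin 2) R, (B ^ 2) 1 0 = B.trace * B 1 0 ∧
      (B ^ 2).trace = B.trace ^ 2 - 2 * B.det := fun B => by
    rw [sq_eq_trace_smul_sub]
    constructor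
    · simp
    · rw [Matrix.trace_sub, Matrix.trace_smul, Matrix.trace_smul, Matrix.trace_one, Fintype.card_fin,
        smul_eq_mul, smul_eq_mul]
      push_cast
      ring
  have h3 : (A ^ 3) 1 0 = (A.trace ^ 2 - A.det) * A 1 0 ∧
      (A ^ 3).trace = A.trace * (A.trace ^ 2 - 3 * A.det) := by
    rw [pow_succ, sq]
    constructor
    all_goals
      simp only [Matrix.mul_apply, Fin.sum_univ_two, Matrix.det_fin_two, Matrix.trace_fin_two]
      ring
  rw [show 12 = 3 * 2 * 2 from rfl, pow_mul, pow_mul, (hsq _).1, (hsq _).1, (hsq _).2, h3.1, h3.2,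
    Matrix.det_pow]
  ring

instance : CompactSpace (Matrix (Fin 2) (Fin 2) ℤ_[2]) :=
  inferInstanceAs (CompactSpace (Fin 2 → Fin 2 → ℤ_[2]))

instance : SecondCountableTopology (Matrix (Fin 2) (Fin 2) ℤ_[2]) :=
  inferInstanceAs (SecondCountableTopology (Fin 2 → Fin 2 → ℤ_[2]))

instance : CompactSpace (GL (Fin 2) ℤ_[2]) :=
  inferInstanceAs (CompactSpace (Matrix (Fin 2) (Fin 2) ℤ_[2])ˣ)

instance : SecondCountableTopology (GL (Fin 2) ℤ_[2]) := by
  have : SecondCountableTopology (Matrix (Fin 2) (Fin 2) ℤ_[2])ᵐᵒᵖ :=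
    MulOpposite.opHomeomorph.symm.isEmbedding.secondCountableTopology
  exact Units.isEmbedding_embedProduct.secondCountableTopology

variable [MeasurableSpace (GL (Fin 2) ℤ_[2])] [BorelSpace (GL (Fin 2) ℤ_[2])]
  (μ : Measure (GL (Fin 2) ℤ_[2])) [μ.IsHaarMeasure]

theorem ae_det_pow_ne_one : ∀ᵐ A ∂μ, A.1.det ^ 12 ≠ 1 := by
  have h3 : IsUnit (3 : ℤ_[2]) := by
    have := isUnit_add_two_mul isUnit_one 1
    norm_num at this
    exact this
  obtain ⟨u, hu⟩ := h3
  have hZ : IsClosed {A : GL (Fin 2) ℤ_[2] | A.1.det ^ 12 = 1} :=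
    isClosed_eq (Units.continuous_val.matrix_det.pow 12) continuous_const
  let d : GL (Fin 2) ℤ_[2] := ⟨!![↑u, 0; 0, 1], !![↑u⁻¹, 0; 0, 1],
    by simp [Matrix.one_fin_two],
    by simp [Matrix.one_fin_two]⟩
  have hd : d.1.det = 3 := by simp [d, Matrix.det_fin_two_of, hu]
  have key := measure_eq_zero_of_finite_translates μ hZ.measurableSet (fun n => d ^ n) fun g => by
    refine Set.Subsingleton.finite fun n hn m hm => ?_
    simp only [Set.mem_ofPred_eq, Units.val_mul, Units.val_pow_eq_pow_val, Matrix.det_mul,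
      Matrix.det_pow, hd] at hn hm
    have hg : g.1.det ^ 12 ≠ 0 := pow_ne_zero _ (Matrix.GeneralLinearGroup.det_ne_zero g)
    have h : ((3 ^ (n * 12) : ℕ) : ℤ_[2]) = ((3 ^ (m * 12) : ℕ) : ℤ_[2]) := by
      apply mul_right_cancel₀ hg
      push_cast
      rw [pow_mul, pow_mul, ← mul_pow, ← mul_pow, hn, hm]
    have := Nat.pow_right_injective (le_refl 3 |>.trans' (by norm_num)) (Nat.cast_injective h)
    omega
  simpa [ae_iff] using key

theorem ae_apply_one_zero_ne_zero : ∀ᵐ A ∂μ, A.1 1 0 ≠ 0 := by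
  have hZ : IsClosed {A : GL (Fin 2) ℤ_[2] | A.1 1 0 = 0} :=
    isClosed_eq (Units.continuous_val.matrix_elem 1 0) continuous_const
  have key := measure_eq_zero_of_finite_translates μ hZ.measurableSet
    (fun n => lowerUnipotent (n : ℤ_[2])) fun g => by
      refine (finite_setOf_natCast_quadratic (a := g.1 1 0) (b := g.1 0 0) (c := 0) ?_).subset
        fun n hn => ?_
      · rintro ⟨h1, h2, -⟩
        apply Matrix.GeneralLinearGroup.det_ne_zero g
        rw [Matrix.det_fin_two, h1, h2]
        ring
      · simp only [Set.mem_ofPred_eq, Units.val_mul, lowerUnipotent, Matrix.mul_apply,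
          Fin.sum_univ_two] at hn ⊢
        simp at hn
        linear_combination hn
  simpa [ae_iff] using key

/-- Left translation by `upperUnipotent n` fixes the determinant and the (1,0) entry and shifts the
trace by n times that entry. Away from the null set where the entry vanishes,
`pow_twelve_apply_one_zero` gives a nonzero polynomial at distinct points. -/
theorem ae_pow_twelve_apply_one_zero_ne_zero : ∀ᵐ A ∂μ, (A.1 ^ 12) 1 0 ≠ 0 := by
  have hZ1 : IsClosed {A : GL (Fin 2) ℤ_[2] | (A.1 ^ 12) 1 0 = 0} :=
    isClosed_eq ((Units.continuous_val.pow 12).matrix_elem 1 0) continuous_const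
  have hZ2 : IsClosed {A : GL (Fin 2) ℤ_[2] | A.1 1 0 = 0} :=
    isClosed_eq (Units.continuous_val.matrix_elem 1 0) continuous_const
  have key := measure_eq_zero_of_finite_translates μ (hZ1.measurableSet.diff hZ2.measurableSet)
    (fun n => upperUnipotent (n : ℤ_[2])) fun g => by
      have e1 : ∀ n : ℕ, (upperUnipotent (n : ℤ_[2]) * g).1 1 0 = g.1 1 0 := fun n => by
        simp [upperUnipotent, Matrix.mul_apply, Fin.sum_univ_two]
      have e2 : ∀ n : ℕ, (upperUnipotent (n : ℤ_[2]) * g).1.trace = g.1.trace + n * g.1 1 0 :=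
        fun n => by
          simp only [upperUnipotent, Units.val_mul, Matrix.mul_apply, Fin.sum_univ_two,
            Matrix.trace_fin_two, Matrix.of_apply, Matrix.cons_val]
          ring
      have e3 : ∀ n : ℕ, (upperUnipotent (n : ℤ_[2]) * g).1.det = g.1.det := fun n => by
        rw [Units.val_mul, Matrix.det_mul]
        simp [upperUnipotent, Matrix.det_fin_two_of]
      by_cases hg : g.1 1 0 = 0
      · convert Set.finite_empty
        rw [Set.eq_empty_iff_forall_notMem]
        rintro n ⟨-, hn⟩
        exact hn ((e1 n).trans hg)
      · let P : Polynomial ℤ_[2] := (Polynomial.X ^ 2 - Polynomial.C g.1.det) *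
          (Polynomial.X * (Polynomial.X ^ 2 - Polynomial.C (3 * g.1.det))) *
          ((Polynomial.X * (Polynomial.X ^ 2 - Polynomial.C (3 * g.1.det))) ^ 2 -
            Polynomial.C (2 * g.1.det ^ 3))
        have hP : P ≠ 0 := by
          have m1 : (Polynomial.X ^ 2 - Polynomial.C g.1.det).Monic :=
            Polynomial.monic_X_pow_sub_C _ two_ne_zero
          have m2 : (Polynomial.X * (Polynomial.X ^ 2 - Polynomial.C (3 * g.1.det))).Monic :=
            Polynomial.monic_X.mul (Polynomial.monic_X_pow_sub_C _ two_ne_zero)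
          have m3 : ((Polynomial.X * (Polynomial.X ^ 2 - Polynomial.C (3 * g.1.det))) ^ 2 -
            Polynomial.C (2 * g.1.det ^ 3)).Monic := by
            refine (m2.pow 2).sub_of_left (Polynomial.degree_C_le.trans_lt ?_)
            rw [(m2.pow 2).degree_pos]
            intro h
            have := congrArg (Polynomial.eval 0) h
            simp at this
          exact ((m1.mul m2).mul m3).ne_zero
        refine (finite_setOf_natCast_isRoot hP (a := g.1.trace) hg).subset fun n hn => ?_
        have hn1 : ((upperUnipotent (n : ℤ_[2]) * g).1 ^ 12) 1 0 = 0 := hn.1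
        rw [pow_twelve_apply_one_zero, e1, e2, e3] at hn1
        have hn2 := (mul_eq_zero.1 hn1).resolve_right hg
        simpa [P] using hn2
  filter_upwards [ae_apply_one_zero_ne_zero μ, measure_eq_zero_iff_ae_notMem.1 key] with A h1 h2 h3
  exact h2 ⟨h3, h1⟩

/-- The quadratic in n vanishes identically only if gAg⁻¹, hence A, is scalar. -/
theorem ae_conj_apply_one_zero_ne_zero {A : GL (Fin 2) ℤ_[2]} (hA : A.1 1 0 ≠ 0) :
    ∀ᵐ B ∂μ, (B * A * B⁻¹).1 1 0 ≠ 0 := by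
  have hZ : IsClosed {B : GL (Fin 2) ℤ_[2] | (B * A * B⁻¹).1 1 0 = 0} :=
    isClosed_eq ((Units.continuous_val.comp (by fun_prop)).matrix_elem 1 0) continuous_const
  have key := measure_eq_zero_of_finite_translates μ hZ.measurableSet
    (fun n => lowerUnipotent (n : ℤ_[2])) fun g => by
      refine (finite_setOf_natCast_quadratic (a := (g * A * g⁻¹).1 1 0)
        (b := (g * A * g⁻¹).1 0 0 - (g * A * g⁻¹).1 1 1) (c := -(g * A * g⁻¹).1 0 1)
        ?_).subset fun n hn => ?_
      · rintro ⟨h1, h2, h3⟩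
        apply hA
        have hA' : A = g⁻¹ * (g * A * g⁻¹) * g := by group
        generalize g * A * g⁻¹ = C at h1 h2 h3 hA'
        have hscalar : C.1 = C.1 0 0 • (1 : Matrix (Fin 2) (Fin 2) ℤ_[2]) := by
          ext i j
          fin_cases i <;> fin_cases j
          · simp
          · simpa using h3
          · simpa using h1
          · simpa using (sub_eq_zero.1 h2).symm
        rw [hA', Units.val_mul, Units.val_mul, hscalar, mul_smul_comm, mul_one, smul_mul_assoc,
          Units.inv_mul]
        simp
      · have hn' : (lowerUnipotent (n : ℤ_[2]) * g * A *
          (lowerUnipotent (n : ℤ_[2]) * g)⁻¹).1 1 0 = 0 := hn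
        rw [mul_conj_eq, lowerUnipotent_conj_apply_one_zero] at hn'
        exact hn'
  simpa [ae_iff] using key

/-- Along upper unipotents the trace is quadratic in n, with leading coefficient minus the product
of the (1,0) entries of A and gAg⁻¹; the locus where the second one vanishes is already null. -/
theorem ae_trace_mul_conj_ne {A : GL (Fin 2) ℤ_[2]} (hA : A.1 1 0 ≠ 0) (r : ℤ_[2]) :
    ∀ᵐ B ∂μ, (A.1 * (B * A * B⁻¹).1).trace ≠ r := by
  have hcont : Continuous fun B : GL (Fin 2) ℤ_[2] => (B * A * B⁻¹).1 :=
    Units.continuous_val.comp (by fun_prop)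
  have hZ1 : IsClosed {B : GL (Fin 2) ℤ_[2] | (A.1 * (B * A * B⁻¹).1).trace = r} :=
    isClosed_eq (continuous_const.mul hcont).matrix_trace continuous_const
  have hZ2 : IsClosed {B : GL (Fin 2) ℤ_[2] | (B * A * B⁻¹).1 1 0 = 0} :=
    isClosed_eq (hcont.matrix_elem 1 0) continuous_const
  have key := measure_eq_zero_of_finite_translates μ (hZ1.measurableSet.diff hZ2.measurableSet)
    (fun n => upperUnipotent (n : ℤ_[2])) fun g => by
      by_cases hg : (g * A * g⁻¹).1 1 0 = 0
      · convert Set.finite_empty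
        rw [Set.eq_empty_iff_forall_notMem]
        rintro n ⟨-, hn⟩
        apply hn
        change (upperUnipotent (n : ℤ_[2]) * g * A * (upperUnipotent (n : ℤ_[2]) * g)⁻¹).1 1 0 = 0
        rw [mul_conj_eq, upperUnipotent_conj]
        exact hg
      · refine (finite_setOf_natCast_quadratic (a := (A.1 * (g * A * g⁻¹).1).trace - r)
          (b := A.1 0 0 * (g * A * g⁻¹).1 1 0 + A.1 1 0 * ((g * A * g⁻¹).1 1 1 -
            (g * A * g⁻¹).1 0 0) - A.1 1 1 * (g * A * g⁻¹).1 1 0)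
          (c := -(A.1 1 0 * (g * A * g⁻¹).1 1 0)) ?_).subset fun n hn => ?_
        · rintro ⟨-, -, h⟩
          exact mul_ne_zero hA hg (neg_eq_zero.1 h)
        · have hn1 : (A.1 * (upperUnipotent (n : ℤ_[2]) * g * A *
            (upperUnipotent (n : ℤ_[2]) * g)⁻¹).1).trace = r := hn.1
          rw [mul_conj_eq, upperUnipotent_conj] at hn1
          generalize g * A * g⁻¹ = C at hn1 ⊢
          simp only [Set.mem_ofPred_eq, Matrix.trace_fin_two, Matrix.mul_apply, Fin.sum_univ_two,
            Matrix.of_apply, Matrix.cons_val] at hn1 ⊢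
          linear_combination hn1
  filter_upwards [ae_conj_apply_one_zero_ne_zero μ hA, measure_eq_zero_iff_ae_notMem.1 key] with
    B h1 h2 h3
  exact h2 ⟨h3, h1⟩

theorem ae_prod_trace_mul_conj_ne {f : GL (Fin 2) ℤ_[2] → ℤ_[2]} (hf : Continuous f) :
    ∀ᵐ p ∂μ.prod μ, (p.1.1 * (p.2 * p.1 * p.2⁻¹).1).trace ≠ f p.1 := by
  have hcont : Continuous fun p : GL (Fin 2) ℤ_[2] × GL (Fin 2) ℤ_[2] =>
      (p.2 * p.1 * p.2⁻¹).1 := Units.continuous_val.comp (by fun_prop)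
  have hZ : IsClosed {p : GL (Fin 2) ℤ_[2] × GL (Fin 2) ℤ_[2] |
      (p.1.1 * (p.2 * p.1 * p.2⁻¹).1).trace = f p.1} :=
    isClosed_eq ((Units.continuous_val.comp continuous_fst).mul hcont).matrix_trace
      (hf.comp continuous_fst)
  have key := (Measure.measure_prod_null (μ := μ) (ν := μ) hZ.measurableSet).2 <| by
    filter_upwards [ae_apply_one_zero_ne_zero μ] with A hA
    simpa [ae_iff] using ae_trace_mul_conj_ne μ hA (f A)
  simpa [ae_iff] using key

end NullSets

/-- `GL (Fin 2) ℤ_[2]` carries the usual topology of a group of units and its Borel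
σ-algebra, and `μ` is an arbitrary Haar measure on it. -/
theorem theorem3 [MeasurableSpace (GL (Fin 2) ℤ_[2])] [BorelSpace (GL (Fin 2) ℤ_[2])]
    (μ : Measure (GL (Fin 2) ℤ_[2])) [μ.IsHaarMeasure] :
    (μ.prod μ) {p : GL (Fin 2) ℤ_[2] × GL (Fin 2) ℤ_[2] |
      ¬ (closedSubgroupGeneratedBy {p.1, p.2}).FiniteIndex} = 0 := by
  rw [← ae_iff]
  have htr : Continuous fun A : GL (Fin 2) ℤ_[2] => A.1.trace := Units.continuous_val.matrix_trace
  have hdet : Continuous fun A : GL (Fin 2) ℤ_[2] => A.1.det := Units.continuous_val.matrix_det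
  filter_upwards [Measure.quasiMeasurePreserving_fst.ae (ae_pow_twelve_apply_one_zero_ne_zero μ),
    Measure.quasiMeasurePreserving_fst.ae (ae_det_pow_ne_one μ),
    ae_prod_trace_mul_conj_ne μ ((htr.pow 2).sub (continuous_const.mul hdet)),
    ae_prod_trace_mul_conj_ne μ (continuous_const.mul hdet)] with p h1 h2 h3 h4
  exact finiteIndex_closedSubgroupGeneratedBy_pair h1 h2 h3 h4
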